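/- All Banach spaces are real. For a Banach space $E$ with dual $E^*$ and a positively homogeneous function $f:E^*\to\mathbb R$ (that is, $f(\lambda x^*)=\lambda f(x^*)$ for all $\lambda>0$ and $x^*\in E^*$), put $$\|f\|_{FBL[E]}=\sup\Big\{\sum_{i=1}^n|f(x_i^*)| : n\in\mathbb N,\ x_1^*,\dots,x_n^*\in E^*,\ \sup_{\|x\|\le 1}\sum_{i=1}^n|x_i^*(x)|\le 1\Big\}\in[0,\infty].$$ Let $H_0[E]$ be the space of all positively homogeneous $f:E^*\to\mathbb R$ with $\|f\|_{FBL[E]}<\infty$, with this norm and the pointwise order, and let $FBL[E]$ (the free Banach lattice generated by $E$) be the closed vector sublattice of $H_0[E]$ generated by the evaluations $\delta_E(x):x^*\mapsto x^*(x)$, $x\in E$. A lattice homomorphism between Banach lattices is a bounded linear operator preserving the lattice operations. For a Banach lattice $X$, let $\beta_X:FBL[X]\to X$ be the unique lattice homomorphism with $\beta_X\circ\delta_X=\mathrm{id}_X$. The Banach lattice $X$ has the lattice-lifting property if there is a lattice homomorphism $T:X\to FBL[X]$ with $\beta_X\circ T=\mathrm{id}_X$. A subspace $A$ of a topological space $S$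 is a retract of $S$ if there is a continuous map $S\to A$ which is the identity on $A$, and a neighborhood retract of $S$ if it is a retract of some open set $U\subseteq S$ containing $A$. A compact Hausdorff space is an absolute neighborhood retract (ANR) if it is a neighborhood retract of every compact Hausdorff space containing it (as a subspace, up to homeomorphism). **Theorem.** Let $K$ be a compact Hausdorff space such that the Banach lattice $C(K)$ of real-valued continuous functions on $K$ (with the supremum norm and the pointwise order) has the lattice-lifting property. Then $K$, identified with the set of evaluation functionals $h\mapsto h(t)$, $t\in K$, is a neighborhood retract of the closed dual unit ball $B_{C(K)^*}$ equipped with the weak$^*$ topology. If in addition $K$ is metrizable, then $K$ is an ANR. -/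

import Mathlib

open scoped ENNReal

universe u v

noncomputable section

namespace LatticeLifting

section FreeBanachLattice

variable (E : Type u) [NormedAddCommGroup E] [NormedSpace ℝ E]

variable {E} in
/-- The quantity `‖f‖_{FBL[E]} ∈ [0, ∞]` of a function `f : E* → ℝ`: the supremum of
`∑ i, |f (φ i)|` over all finite families `φ` in `E*` with
`sup_{x ∈ B_E} ∑ i, |φ i x| ≤ 1`. -/
def fblENorm (f : StrongDual ℝ E → ℝ) : ℝ≥0∞ :=
  ⨆ (n : ℕ) (φ : Fin n → StrongDual ℝ E) (_ : ∀ x : E, ‖x‖ ≤ 1 → ∑ i, |φ i x| ≤ 1),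
    ∑ i, ‖f (φ i)‖ₑ

variable {E} in
/-- `f (c • φ) = c * f φ` for all `c > 0`. -/
def PosHomogeneous (f : StrongDual ℝ E → ℝ) : Prop :=
  ∀ (c : ℝ) (φ : StrongDual ℝ E), 0 < c → f (c • φ) = c * f φ

variable {E}

theorem le_fblENorm (f : StrongDual ℝ E → ℝ) {n : ℕ} (φ : Fin n → StrongDual ℝ E)
    (h : ∀ x : E, ‖x‖ ≤ 1 → ∑ i, |φ i x| ≤ 1) : ∑ i, ‖f (φ i)‖ₑ ≤ fblENorm f :=
  le_iSup_of_le n (le_iSup_of_le φ (le_iSup_of_le h le_rfl))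

theorem fblENorm_le {f : StrongDual ℝ E → ℝ} {C : ℝ≥0∞}
    (H : ∀ (n : ℕ) (φ : Fin n → StrongDual ℝ E),
      (∀ x : E, ‖x‖ ≤ 1 → ∑ i, |φ i x| ≤ 1) → ∑ i, ‖f (φ i)‖ₑ ≤ C) : fblENorm f ≤ C :=
  iSup_le fun n => iSup_le fun φ => iSup_le fun h => H n φ h

theorem fblENorm_zero : fblENorm (0 : StrongDual ℝ E → ℝ) = 0 :=
  le_antisymm (fblENorm_le fun n φ _ => by simp) bot_le

theorem fblENorm_le_add {f g h : StrongDual ℝ E → ℝ} (H : ∀ φ, |f φ| ≤ |g φ| + |h φ|) :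
    fblENorm f ≤ fblENorm g + fblENorm h := by
  refine fblENorm_le fun n φ hφ => ?_
  refine le_trans ?_ (add_le_add (le_fblENorm g φ hφ) (le_fblENorm h φ hφ))
  rw [← Finset.sum_add_distrib]
  refine Finset.sum_le_sum fun i _ => ?_
  simp only [Real.enorm_eq_ofReal_abs]
  rw [← ENNReal.ofReal_add (abs_nonneg _) (abs_nonneg _)]
  exact ENNReal.ofReal_le_ofReal (H (φ i))

theorem fblENorm_smul_le (c : ℝ) (f : StrongDual ℝ E → ℝ) :
    fblENorm (c • f) ≤ ‖c‖ₑ * fblENorm f := by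
  refine fblENorm_le fun n φ hφ => ?_
  refine le_trans (le_of_eq ?_) (mul_le_mul_right (le_fblENorm f φ hφ) _)
  rw [Finset.mul_sum]
  simp [enorm_mul]

theorem eq_zero_of_fblENorm {f : StrongDual ℝ E → ℝ} (hf : PosHomogeneous f)
    (h0 : fblENorm f = 0) : f = 0 := by
  funext φ
  have hz : f 0 = 0 := by
    have := hf 2 0 two_pos
    simp only [smul_zero] at this
    linarith
  by_cases hφ : φ = 0
  · simp [hφ, hz]
  have hpos : 0 < ‖φ‖ := norm_pos_iff.2 hφ
  have h1 := le_fblENorm f (fun _ : Fin 1 => ‖φ‖⁻¹ • φ) (fun x hx => by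
    simp only [Finset.univ_unique, Finset.sum_singleton, smul_apply,
      smul_eq_mul, abs_mul, abs_inv, abs_norm]
    rw [inv_mul_le_iff₀ hpos]
    have := φ.le_opNorm x
    rw [Real.norm_eq_abs] at this
    nlinarith)
  rw [h0] at h1
  simp only [Finset.univ_unique, Finset.sum_singleton, nonpos_iff_eq_zero, enorm_eq_zero] at h1
  rw [hf _ _ (inv_pos.2 hpos)] at h1
  simpa [hpos.ne'] using h1

variable (E)

/-- The positively homogeneous functions `f : E* → ℝ` with `‖f‖_{FBL[E]} < ∞`. -/
def hZeroSubmodule : Submodule ℝ (StrongDual ℝ E → ℝ) where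
  carrier := {f | PosHomogeneous f ∧ fblENorm f < ∞}
  zero_mem' := ⟨fun c φ _ => by simp, by rw [fblENorm_zero]; exact ENNReal.zero_lt_top⟩
  add_mem' {f g} hf hg := ⟨fun c φ hc => by
      simp only [Pi.add_apply, hf.1 c φ hc, hg.1 c φ hc, mul_add],
    (fblENorm_le_add fun φ => abs_add_le _ _).trans_lt (ENNReal.add_lt_top.2 ⟨hf.2, hg.2⟩)⟩
  smul_mem' a f hf := ⟨fun c φ hc => by
      simp only [Pi.smul_apply, hf.1 c φ hc, smul_eq_mul]; ring,
    (fblENorm_smul_le a f).trans_lt (ENNReal.mul_lt_top enorm_lt_top hf.2)⟩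

variable {E} in
theorem sup_mem_hZeroSubmodule {f g : StrongDual ℝ E → ℝ} (hf : f ∈ hZeroSubmodule E)
    (hg : g ∈ hZeroSubmodule E) : f ⊔ g ∈ hZeroSubmodule E :=
  ⟨fun c φ hc => by
      simp only [Pi.sup_apply, hf.1 c φ hc, hg.1 c φ hc, mul_max_of_nonneg _ _ hc.le],
    (fblENorm_le_add fun φ => abs_max_le_max_abs_abs.trans
      (max_le_add_of_nonneg (abs_nonneg _) (abs_nonneg _))).trans_lt
      (ENNReal.add_lt_top.2 ⟨hf.2, hg.2⟩)⟩

variable {E} in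
theorem inf_mem_hZeroSubmodule {f g : StrongDual ℝ E → ℝ} (hf : f ∈ hZeroSubmodule E)
    (hg : g ∈ hZeroSubmodule E) : f ⊓ g ∈ hZeroSubmodule E := by
  have h := neg_mem (sup_mem_hZeroSubmodule (neg_mem hf) (neg_mem hg))
  rwa [neg_sup, neg_neg, neg_neg] at h

/-- The space `H₀[E]` of positively homogeneous functions `f : E* → ℝ` with
`‖f‖_{FBL[E]} < ∞`, with pointwise operations, the pointwise order and the norm
`‖·‖_{FBL[E]}`. (It is a type of its own, so that its topology is the norm topology and not
that of pointwise convergence.) -/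
def HZero : Type u := hZeroSubmodule E

instance : AddCommGroup (HZero E) := inferInstanceAs (AddCommGroup (hZeroSubmodule E))

instance : Module ℝ (HZero E) := inferInstanceAs (Module ℝ (hZeroSubmodule E))

instance : CoeFun (HZero E) (fun _ => StrongDual ℝ E → ℝ) := ⟨fun f => f.1⟩

instance : Lattice (HZero E) :=
  Subtype.lattice (P := fun f => f ∈ hZeroSubmodule E)
    (fun _ _ hf hg => sup_mem_hZeroSubmodule hf hg)
    (fun _ _ hf hg => inf_mem_hZeroSubmodule hf hg)

instance : Norm (HZero E) := ⟨fun f => (fblENorm f.1).toReal⟩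

theorem hZero_normCore : NormedSpace.Core ℝ (HZero E) where
  norm_nonneg _ := ENNReal.toReal_nonneg
  norm_smul c f := by
    have key : ∀ (a : ℝ) (g : HZero E), ‖a • g‖ ≤ ‖a‖ * ‖g‖ := fun a g => by
      have h := ENNReal.toReal_mono (ENNReal.mul_lt_top enorm_lt_top g.2.2).ne
        (fblENorm_smul_le a g.1)
      rwa [ENNReal.toReal_mul, toReal_enorm] at h
    refine le_antisymm (key c f) ?_
    by_cases hc : c = 0
    · subst hc
      rw [norm_zero, zero_mul]
      exact ENNReal.toReal_nonneg
    · have h := key c⁻¹ (c • f)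
      rw [inv_smul_smul₀ hc, norm_inv, inv_mul_eq_div, le_div_iff₀ (norm_pos_iff.2 hc)] at h
      linarith
  norm_triangle f g := by
    have h := ENNReal.toReal_mono (ENNReal.add_lt_top.2 ⟨f.2.2, g.2.2⟩).ne
      (fblENorm_le_add (f := f.1 + g.1) (g := f.1) (h := g.1) fun φ => abs_add_le _ _)
    rwa [ENNReal.toReal_add f.2.2.ne g.2.2.ne] at h
  norm_eq_zero_iff f := by
    constructor
    · intro h
      rcases (ENNReal.toReal_eq_zero_iff _).1 h with h | h
      · exact Subtype.ext (eq_zero_of_fblENorm f.2.1 h)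
      · exact absurd h f.2.2.ne
    · rintro rfl
      change (fblENorm (0 : StrongDual ℝ E → ℝ)).toReal = 0
      rw [fblENorm_zero, ENNReal.toReal_zero]

instance : NormedAddCommGroup (HZero E) := NormedAddCommGroup.ofCore (hZero_normCore E)

instance : NormedSpace ℝ (HZero E) := NormedSpace.ofCore (hZero_normCore E)

variable {E} in
theorem delta_mem (x : E) : (fun φ : StrongDual ℝ E => φ x) ∈ hZeroSubmodule E := by
  refine ⟨fun c φ _ => by simp, lt_of_le_of_lt (b := ENNReal.ofReal ‖x‖)
    (fblENorm_le fun n φ hφ => ?_) ENNReal.ofReal_lt_top⟩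
  simp only [Real.enorm_eq_ofReal_abs]
  rw [← ENNReal.ofReal_sum_of_nonneg fun i _ => abs_nonneg _]
  refine ENNReal.ofReal_le_ofReal ?_
  by_cases hx : x = 0
  · simp [hx]
  have hpos : 0 < ‖x‖ := norm_pos_iff.2 hx
  have h := hφ (‖x‖⁻¹ • x) (by rw [norm_smul, norm_inv, norm_norm, inv_mul_cancel₀ hpos.ne'])
  simp only [map_smul, smul_eq_mul, abs_mul, abs_inv, abs_norm, ← Finset.mul_sum] at h
  rwa [inv_mul_le_iff₀ hpos, mul_one] at h

variable {E} in
/-- The evaluation function `δ_E(x) : φ ↦ φ x`, as an element of `H₀[E]`. -/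
def deltaHZero (x : E) : HZero E := ⟨fun φ => φ x, delta_mem x⟩

/-- The closed vector sublattice of `H₀[E]` generated by the evaluations `δ_E(x)`, `x ∈ E`: the
intersection of all closed linear subspaces of `H₀[E]` that are stable under the lattice
operations and contain all `δ_E(x)`. -/
def fblSubmodule : Submodule ℝ (HZero E) :=
  sInf {S | IsClosed (S : Set (HZero E)) ∧ (∀ f ∈ S, ∀ g ∈ S, f ⊔ g ∈ S ∧ f ⊓ g ∈ S) ∧
    ∀ x : E, deltaHZero x ∈ S}

/-- The free Banach lattice `FBL[E]` generated by `E`, with the norm inherited from `H₀[E]`. -/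
abbrev FBL : Type u := fblSubmodule E

/-- `FBL[E]` carries the pointwise lattice operations. -/
instance : Lattice (FBL E) :=
  Subtype.lattice (P := fun f => f ∈ fblSubmodule E)
    (fun f g hf hg => by
      rw [fblSubmodule, Submodule.mem_sInf] at hf hg ⊢
      exact fun S hS => (hS.2.1 f (hf S hS) g (hg S hS)).1)
    (fun f g hf hg => by
      rw [fblSubmodule, Submodule.mem_sInf] at hf hg ⊢
      exact fun S hS => (hS.2.1 f (hf S hS) g (hg S hS)).2)

variable {E} in
/-- The canonical map `δ_E : E → FBL[E]`. -/
def delta (x : E) : FBL E :=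
  ⟨deltaHZero x, by
    rw [fblSubmodule, Submodule.mem_sInf]
    exact fun S hS => hS.2.2 x⟩

end FreeBanachLattice

/-- A bounded linear operator is a lattice homomorphism if it preserves the lattice operations. -/
def IsLatticeHom {X : Type u} {Y : Type v} [NormedAddCommGroup X] [NormedSpace ℝ X] [Lattice X]
    [NormedAddCommGroup Y] [NormedSpace ℝ Y] [Lattice Y] (T : X →L[ℝ] Y) : Prop :=
  ∀ x y : X, T (x ⊔ y) = T x ⊔ T y ∧ T (x ⊓ y) = T x ⊓ T y

/-- `β` is the map `β_X : FBL[X] → X`, the lattice homomorphism with `β_X ∘ δ_X = id_X`. Such a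
map always exists, and it is unique since `FBL[X]` is generated by the range of `δ_X`. -/
def IsBeta {X : Type u} [NormedAddCommGroup X] [NormedSpace ℝ X] [Lattice X]
    (β : FBL X →L[ℝ] X) : Prop :=
  IsLatticeHom β ∧ ∀ x : X, β (delta x) = x

section Beta

theorem fbl_mem_of_closed {E : Type u} [NormedAddCommGroup E] [NormedSpace ℝ E]
    (S : Submodule ℝ (HZero E)) (h1 : IsClosed (S : Set (HZero E)))
    (h2 : ∀ f ∈ S, ∀ g ∈ S, f ⊔ g ∈ S ∧ f ⊓ g ∈ S) (h3 : ∀ x, deltaHZero x ∈ S) (f : FBL E) :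
    f.1 ∈ S :=
  (Submodule.mem_sInf.1 f.2) S ⟨h1, h2, h3⟩

/-- The map `β_X` is unique. -/
theorem isBeta_unique {X : Type u} [NormedAddCommGroup X] [NormedSpace ℝ X] [Lattice X]
    (β γ : FBL X →L[ℝ] X) (hβ : IsBeta β) (hγ : IsBeta γ) : β = γ := by
  let S : Submodule ℝ (HZero X) := 
    (LinearMap.eqLocus β.toLinearMap γ.toLinearMap).map (fblSubmodule X).subtype
  ext f
  have : f.1 ∈ S := by
    refine fbl_mem_of_closed S ?_ ?_ ?_ f
    · have hc : IsClosed (fblSubmodule X : Set (HZero X)) := by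
        simp only [fblSubmodule, Submodule.coe_sInf]
        exact isClosed_biInter fun S hS => hS.1
      exact hc.isClosedEmbedding_subtypeVal.isClosedMap _ (isClosed_eq β.continuous γ.continuous)
    · rintro _ ⟨f, hf, rfl⟩ _ ⟨g, hg, rfl⟩
      have hf : β f = γ f := hf
      have hg : β g = γ g := hg
      exact ⟨⟨f ⊔ g, show β _ = γ _ by rw [(hβ.1 _ _).1, (hγ.1 _ _).1, hf, hg], rfl⟩,
        ⟨f ⊓ g, show β _ = γ _ by rw [(hβ.1 _ _).2, (hγ.1 _ _).2, hf, hg], rfl⟩⟩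
    · exact fun x => ⟨delta x, show β _ = γ _ by rw [hβ.2, hγ.2], rfl⟩
  obtain ⟨g, hg, hgf⟩ := this
  have : g = f := Subtype.ext hgf
  subst this
  exact hg

variable {K : Type u} [TopologicalSpace K] [CompactSpace K]

theorem abs_eval_le (f : HZero C(K, ℝ)) (t : K) : |f.1 (ContinuousMap.evalCLM ℝ t)| ≤ ‖f‖ := by
  have h := le_fblENorm f.1 (fun _ : Fin 1 => ContinuousMap.evalCLM ℝ t) (fun x hx => by
    simpa using (x.norm_coe_le_norm t).trans hx)
  have h2 := ENNReal.toReal_mono f.2.2.ne h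
  change _ ≤ (fblENorm f.1).toReal
  simpa using h2

variable (K) in
/-- The `f ∈ H₀[C(K)]` that are continuous along the evaluations `h ↦ h t`, `t ∈ K`. -/
def evalContinuous : Submodule ℝ (HZero C(K, ℝ)) where
  carrier := {f | Continuous fun t : K => f.1 (ContinuousMap.evalCLM ℝ t)}
  zero_mem' := continuous_const (y := (0:ℝ))
  add_mem' hf hg := Continuous.add hf hg
  smul_mem' c f hf := Continuous.const_smul (α := ℝ) hf c

theorem fbl_evalContinuous (f : FBL C(K, ℝ)) :
    Continuous fun t : K => f.1.1 (ContinuousMap.evalCLM ℝ t) := by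
  refine fbl_mem_of_closed (evalContinuous K) ?_ ?_ ?_ f
  · refine isClosed_of_closure_subset fun f hf => ?_
    refine continuous_of_uniform_approx_of_continuous (α := K) (β := ℝ) fun s hs => ?_
    obtain ⟨ε, hε, h⟩ := Metric.mem_uniformity_dist.1 hs
    obtain ⟨g, hg, hgd⟩ := Metric.mem_closure_iff.1 hf ε hε
    refine ⟨_, hg, fun t => h ?_⟩
    rw [dist_eq_norm] at hgd
    exact (abs_eval_le (f - g) t).trans_lt hgd
  · exact fun _ hf _ hg => ⟨Continuous.max hf hg, Continuous.min hf hg⟩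
  · exact fun x => x.continuous

/-- For `X = C(K)` the map `β_X` is `f ↦ (t ↦ f(δ_t))`. -/
theorem exists_isBeta_continuousMap : ∃ β : FBL C(K, ℝ) →L[ℝ] C(K, ℝ), IsBeta β := by
  refine ⟨LinearMap.mkContinuous
    ⟨⟨fun f => ⟨_, fbl_evalContinuous f⟩, fun _ _ => rfl⟩, fun _ _ => rfl⟩ 1 ?_, ?_, ?_⟩
  · intro f
    rw [one_mul]
    exact (ContinuousMap.norm_le _ (norm_nonneg _)).2 fun t => abs_eval_le f.1 t
  · exact fun x y => ⟨rfl, rfl⟩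
  · exact fun x => rfl

end Beta

/-- The lattice-lifting property of a Banach lattice `X`: there is a lattice homomorphism
`T : X → FBL[X]` such that `β_X ∘ T = id_X`. -/
def HasLatticeLifting (X : Type u) [NormedAddCommGroup X] [NormedSpace ℝ X] [Lattice X] : Prop :=
  ∃ β : FBL X →L[ℝ] X, IsBeta β ∧ ∃ T : X →L[ℝ] FBL X, IsLatticeHom T ∧ ∀ x : X, β (T x) = x

section Retracts

/-- `A ⊆ T` is a retract of `T`: there is a continuous map `T → A` which is the identity
on `A`. -/
def IsRetract {T : Type u} [TopologicalSpace T] (A : Set T) : Prop :=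
  ∃ r : C(T, A), ∀ a : A, r (a : T) = a

/-- `A ⊆ T` is a neighborhood retract of `T`: it is a retract of some open `U ⊇ A`. -/
def IsNeighborhoodRetract {T : Type u} [TopologicalSpace T] (A : Set T) : Prop :=
  ∃ U : Set T, IsOpen U ∧ A ⊆ U ∧ IsRetract ((↑) ⁻¹' A : Set U)

/-- The compact space `K` is an absolute neighborhood retract: it is a neighborhood retract of
any compact (Hausdorff) space `L` containing (a homeomorphic copy of) it. The spaces `L` may be
taken from any universe. -/
def IsANR (K : Type u) [TopologicalSpace K] : Prop :=
  ∀ (L : Type v) [TopologicalSpace L] [CompactSpace L] [T2Space L] (i : K → L),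
    Topology.IsEmbedding i → IsNeighborhoodRetract (Set.range i)

end Retracts

section DualBall

/-- The closed dual unit ball `B_{X*}` with the weak* topology. -/
abbrev DualBall (X : Type u) [NormedAddCommGroup X] [NormedSpace ℝ X] : Type u :=
  {φ : WeakDual ℝ X // ‖WeakDual.toStrongDual φ‖ ≤ 1}

/-- The canonical map `K → B_{C(K)*}`, sending `t` to the evaluation `h ↦ h t`. -/
def evalBall {K : Type u} [TopologicalSpace K] [CompactSpace K] (t : K) : DualBall C(K, ℝ) :=
  ⟨StrongDual.toWeakDual (ContinuousMap.evalCLM ℝ t),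
    ContinuousLinearMap.opNorm_le_bound _ zero_le_one fun h => by
      simpa using h.norm_coe_le_norm t⟩

end DualBall

end LatticeLifting

end

/-! Let `T` be a lifting. Operations in `FBL[C(K)]` are pointwise, so for each `φ` in the dual ball
`h ↦ (T h)(φ)` is a real-valued lattice homomorphism on `C(K)`. It varies weak* continuously with
`φ`, and at the evaluation at `t` it is `h ↦ h t`, because `β` restricts functions to evaluations.
On the open set `U` where `(T 1)(φ) > 0`, dividing by `(T 1)(φ)` makes it unital, hence evaluation
at a point `r φ` (`exists_eq_eval_of_map_sup`). Then `r : U → K` is continuous and inverts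
`evalBall` (`exists_local_retraction`).

If `K` is metrizable and embedded in a compact `L`, the map `evalBall` extends to `F : L →
B_{C(K)*}`: Tietze maps `L` to the Hilbert cube, and a Dugundji-type averaging maps the cube to the
ball (`exists_extension_evalBall`). Then `r ∘ F` on `F⁻¹(U)` gives the neighborhood retraction. -/

namespace LatticeLifting

open Topology Set Filter

/-! ### Weak* continuity on the dual ball -/

section Evaluation

variable {E : Type u} [NormedAddCommGroup E] [NormedSpace ℝ E]

/-- A single functional of norm at most one is an admissible family, so norm convergence in `H₀[E]`
is uniform on the dual ball. -/
theorem abs_apply_le_norm (f : HZero E) {φ : StrongDual ℝ E} (hφ : ‖φ‖ ≤ 1) :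
    |f.1 φ| ≤ ‖f‖ := by
  have h := le_fblENorm f.1 (fun _ : Fin 1 => φ) (fun x hx => by
    have h1 := φ.le_of_opNorm_le_of_le hφ hx
    simpa using h1)
  have h2 := ENNReal.toReal_mono f.2.2.ne h
  change _ ≤ (fblENorm f.1).toReal
  simpa using h2

variable (E) in
/-- The `f ∈ H₀[E]` that are weak* continuous on the closed dual unit ball. -/
def ballContinuous : Submodule ℝ (HZero E) where
  carrier := {f | Continuous fun φ : DualBall E => f.1 (WeakDual.toStrongDual φ.1)}
  zero_mem' := continuous_const (y := (0:ℝ))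
  add_mem' hf hg := Continuous.add hf hg
  smul_mem' c _ hf := Continuous.const_smul (α := ℝ) hf c

theorem isClosed_ballContinuous : IsClosed (ballContinuous E : Set (HZero E)) := by
  refine isClosed_of_closure_subset fun f hf => ?_
  refine continuous_of_uniform_approx_of_continuous (α := DualBall E) (β := ℝ) fun s hs => ?_
  obtain ⟨ε, hε, h⟩ := Metric.mem_uniformity_dist.1 hs
  obtain ⟨g, hg, hgd⟩ := Metric.mem_closure_iff.1 hf ε hε
  refine ⟨_, hg, fun φ => h ?_⟩
  rw [dist_eq_norm] at hgd
  exact (abs_apply_le_norm (f - g) φ.2).trans_lt hgd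

/-- The functions with this continuity form a closed sublattice containing every evaluation, hence
all of `FBL[E]`. -/
theorem fbl_continuous_dualBall (f : FBL E) :
    Continuous fun φ : DualBall E => f.1.1 (WeakDual.toStrongDual φ.1) :=
  fbl_mem_of_closed (ballContinuous E) isClosed_ballContinuous
    (fun _ hf _ hg => ⟨Continuous.max hf hg, Continuous.min hf hg⟩)
    (fun x => (WeakDual.eval_continuous x).comp continuous_subtype_val) f

end Evaluation

/-! ### From a lifting to a local retraction -/

section LatticeHom

variable {K : Type u} [TopologicalSpace K] [CompactSpace K]

theorem IsBeta.apply_eq {β : FBL C(K, ℝ) →L[ℝ] C(K, ℝ)} (hβ : IsBeta β) (f : FBL C(K, ℝ))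
    (t : K) : β f t = f.1.1 (ContinuousMap.evalCLM ℝ t) := by
  let γ : FBL C(K, ℝ) →L[ℝ] C(K, ℝ) := LinearMap.mkContinuous
    ⟨⟨fun f => ⟨_, fbl_evalContinuous f⟩, fun _ _ => rfl⟩, fun _ _ => rfl⟩ 1 fun f => by
      rw [one_mul]
      exact (ContinuousMap.norm_le _ (norm_nonneg _)).2 fun t => abs_eval_le f.1 t
  have hγ : IsBeta γ := ⟨fun x y => ⟨rfl, rfl⟩, fun x => rfl⟩
  rw [isBeta_unique β γ hβ hγ]
  rfl

/-- A unital lattice homomorphism `C(K) → ℝ` is the evaluation at a point. -/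
theorem exists_eq_eval_of_map_sup (ψ : C(K, ℝ) →ₗ[ℝ] ℝ)
    (hsup : ∀ f g, ψ (f ⊔ g) = ψ f ⊔ ψ g) (hone : ψ 1 = 1) : ∃ t, ∀ h, ψ h = h t := by
  by_contra! H
  choose h hh using H
  have habs (f : C(K, ℝ)) : ψ |f| = |ψ f| := by
    rw [abs, hsup, map_neg]; rfl
  have hmono {f g : C(K, ℝ)} (hfg : f ≤ g) : ψ f ≤ ψ g := by
    rw [← sup_eq_right.2 hfg, hsup]; exact le_sup_left
  -- Each `g t` is killed by `ψ` and positive at `t`. By compactness a finite sum is killed by `ψ`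
  -- yet bounded below by some `ε > 0`, against `ψ 1 = 1`.
  let g (t : K) : C(K, ℝ) := |h t - ψ (h t) • 1|
  have hg0 (t : K) : ψ (g t) = 0 := by simp [g, habs, hone]
  have hgpos (t : K) : 0 < g t t := by
    simpa [g, sub_eq_zero] using (hh t).symm
  have hgnn (t s : K) : 0 ≤ g t s := by
    simp [g]
  obtain ⟨F, hF⟩ := isCompact_univ.elim_finite_subcover (fun t => {s | 0 < g t s})
    (fun t => isOpen_lt continuous_const (g t).continuous)
    (fun s _ => mem_iUnion.2 ⟨s, hgpos s⟩)
  let G : C(K, ℝ) := ∑ t ∈ F, g t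
  have hG0 : ψ G = 0 := by simp [G, hg0]
  have hGpos (s : K) : 0 < G s := by
    obtain ⟨t, ht, hs⟩ := mem_iUnion₂.1 (hF (mem_univ s))
    simp only [G, ContinuousMap.sum_apply]
    exact Finset.sum_pos' (fun i _ => hgnn i s) ⟨t, ht, hs⟩
  have : ∃ ε > 0, ∀ s, ε ≤ G s := by
    rcases isEmpty_or_nonempty K with _ | _
    · exact ⟨1, one_pos, fun s => isEmptyElim s⟩
    · obtain ⟨s, -, hs⟩ := isCompact_univ.exists_isMinOn univ_nonempty G.continuous.continuousOn
      exact ⟨G s, hGpos s, fun t => hs (mem_univ t)⟩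
  obtain ⟨ε, hε, hle⟩ := this
  have := hmono (f := ε • 1) (g := G) (fun s => by simpa using hle s)
  rw [map_smul, hone, hG0, smul_eq_mul, mul_one] at this
  exact absurd this hε.not_ge

/-- By Urysohn, `K` carries the topology induced by `C(K)`. -/
theorem continuous_of_forall_continuous_comp [T2Space K] {X : Type*} [TopologicalSpace X]
    {r : X → K} (hr : ∀ h : C(K, ℝ), Continuous fun x => h (r x)) : Continuous r := by
  refine continuous_iff_continuousAt.2 fun x => ?_
  rw [ContinuousAt, tendsto_nhds]
  intro V hV hx
  obtain ⟨h, h0, h1, -⟩ := exists_continuous_zero_one_of_isClosed hV.isClosed_compl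
    (isClosed_singleton (x := r x)) (disjoint_singleton_right.2 fun hn => hn hx)
  have : ∀ᶠ y in 𝓝 x, 0 < h (r y) :=
    (hr h).continuousAt.eventually (lt_mem_nhds (by simp [h1 (mem_singleton (r x))]))
  filter_upwards [this] with y hy
  by_contra hn
  exact hy.ne' (h0 hn)

theorem exists_local_retraction [T2Space K] (hK : HasLatticeLifting C(K, ℝ)) :
    ∃ (U : Set (DualBall C(K, ℝ))) (r : C(U, K)), IsOpen U ∧
      ∀ t, ∃ ht : evalBall t ∈ U, r ⟨evalBall t, ht⟩ = t := by
  obtain ⟨β, hβ, T, hT, hβT⟩ := hK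
  let ev (φ : DualBall C(K, ℝ)) (h : C(K, ℝ)) : ℝ := (T h).1.1 (WeakDual.toStrongDual φ.1)
  have hcont (h : C(K, ℝ)) : Continuous fun φ => ev φ h := fbl_continuous_dualBall (T h)
  have hadd (φ) (f g : C(K, ℝ)) : ev φ (f + g) = ev φ f + ev φ g := by
    simp only [ev, map_add]; rfl
  have hsmul (φ) (c : ℝ) (f : C(K, ℝ)) : ev φ (c • f) = c * ev φ f := by
    simp only [ev, map_smul]; rfl
  have hsup (φ) (f g : C(K, ℝ)) : ev φ (f ⊔ g) = ev φ f ⊔ ev φ g := by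
    simp only [ev, (hT f g).1]; rfl
  have hev (t : K) (h : C(K, ℝ)) : ev (evalBall t) h = h t := by
    conv_rhs => rw [← hβT h, hβ.apply_eq]
    rfl
  have key (φ : {φ // 0 < ev φ 1}) : ∃ t, ∀ h, (ev φ.1 1)⁻¹ * ev φ.1 h = h t :=
    exists_eq_eval_of_map_sup
      ⟨⟨fun h => (ev φ.1 1)⁻¹ * ev φ.1 h, fun f g => by rw [hadd, mul_add]⟩,
        fun c f => by simp only [hsmul, RingHom.id_apply, smul_eq_mul]; ring⟩
      (fun f g => by
        simp only [LinearMap.coe_mk, AddHom.coe_mk, hsup]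
        exact mul_max_of_nonneg _ _ (inv_nonneg.2 φ.2.le))
      (inv_mul_cancel₀ φ.2.ne')
  choose r hr using key
  have hrc : Continuous r := continuous_of_forall_continuous_comp fun h => by
    simp only [← hr]
    exact (((hcont 1).comp continuous_subtype_val).inv₀ fun φ => φ.2.ne').mul
      ((hcont h).comp continuous_subtype_val)
  refine ⟨{φ | 0 < ev φ 1}, ⟨r, hrc⟩, isOpen_lt continuous_const (hcont 1), fun t => ?_⟩
  have ht : 0 < ev (evalBall t) 1 := by simp [hev]
  refine ⟨ht, ?_⟩
  -- A Urysohn function separating `t` from its image would give `1 = 0`.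
  by_contra hne
  obtain ⟨h, h0, h1, -⟩ := exists_continuous_zero_one_of_isClosed
    (isClosed_singleton (x := r ⟨evalBall t, ht⟩)) (isClosed_singleton (x := t))
    (by simpa using hne)
  have h2 := hr ⟨evalBall t, ht⟩ h
  rw [h0 (mem_singleton _), hev, hev, h1 (mem_singleton t)] at h2
  simp at h2

end LatticeHom

/-! ### Extending the canonical map into the dual ball -/

section Extension

variable {K : Type u} [TopologicalSpace K] [CompactSpace K]

theorem continuous_evalBall : Continuous (evalBall : K → DualBall C(K, ℝ)) :=
  (WeakDual.continuous_of_continuous_eval fun h => h.continuous).subtype_mk _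

/-- A pointwise continuous family of functionals of norm at most one on `C(K)` is a continuous map
into the dual ball. -/
theorem exists_continuousMap_dualBall {Y : Type*} [TopologicalSpace Y] (G : Y → C(K, ℝ) →ₗ[ℝ] ℝ)
    (hG : ∀ y h, |G y h| ≤ ‖h‖) (hc : ∀ h, Continuous fun y => G y h) :
    ∃ F : C(Y, DualBall C(K, ℝ)), ∀ y h, (F y).1 h = G y h := by
  have hG' (y : Y) (h : C(K, ℝ)) : ‖G y h‖ ≤ 1 * ‖h‖ := by rw [one_mul]; exact hG y h
  refine ⟨⟨fun y => ⟨StrongDual.toWeakDual ((G y).mkContinuous 1 (hG' y)),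
    LinearMap.mkContinuous_norm_le _ zero_le_one (hG' y)⟩,
    (WeakDual.continuous_of_continuous_eval fun h => ?_).subtype_mk _⟩, fun y h => rfl⟩
  exact hc h

/-- A norm-one simultaneous extension: the canonical map `K → B_{C(K)*}` extends continuously
along any embedding of the compact space `K` into a metric space. -/
theorem exists_extension_evalBall {Y : Type*} [MetricSpace Y] {e : K → Y} (he : IsEmbedding e) :
    ∃ F : C(Y, DualBall C(K, ℝ)), ∀ t, F (e t) = evalBall t := by
  rcases isEmpty_or_nonempty K with hK | hK
  · obtain ⟨F, -⟩ := exists_continuousMap_dualBall (Y := Y) (K := K) (fun _ => 0)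
      (fun y h => by simp) (fun h => continuous_const)
    exact ⟨F, fun t => hK.elim t⟩
  have hcl : IsClosed (range e) := (isCompact_range he.continuous).isClosed
  have hne : (range e).Nonempty := range_nonempty e
  -- The metric pulled back from `Y` makes `K` separable.
  let := he.comapMetricSpace
  let a : ℕ → K := TopologicalSpace.denseSeq K
  let δ (y : Y) : ℝ := Metric.infDist y (range e)
  -- Only points `t` with `dist y (e t) < 2 * δ y` get weight; the factor 2 guarantees some exist
  -- when `δ y > 0`. The cap at 1 makes the series below converge uniformly.
  let w (y : Y) (t : K) : ℝ := min 1 (max 0 (2 * δ y - dist y (e t)))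
  have hw0 (y t) : 0 ≤ w y t := le_min zero_le_one (le_max_left _ _)
  have hw1 (y t) : w y t ≤ 1 := min_le_left _ _
  have hwc (t) : Continuous fun y => w y t := by
    have : Continuous δ := Metric.continuous_infDist_pt _
    fun_prop
  let u (h : C(K, ℝ)) (y : Y) (n : ℕ) : ℝ := (1 / 2) ^ n * (w y (a n) * h (a n))
  have hu (h y n) : ‖u h y n‖ ≤ (1 / 2) ^ n * ‖h‖ := by
    simp only [u, norm_mul, norm_pow]
    have h1 : ‖(1 / 2 : ℝ)‖ = 1 / 2 := by norm_num
    rw [h1]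
    gcongr
    rw [Real.norm_of_nonneg (hw0 _ _)]
    exact (mul_le_of_le_one_left (norm_nonneg _) (hw1 _ _)).trans (h.norm_coe_le_norm _)
  have hgeom (C : ℝ) : Summable fun n : ℕ => (1 / 2 : ℝ) ^ n * C :=
    summable_geometric_two.mul_right C
  have hsum (h y) : Summable (u h y) := (hgeom ‖h‖).of_norm_bounded (hu h y)
  let N (h : C(K, ℝ)) (y : Y) : ℝ := ∑' n, u h y n
  have hNc (h) : Continuous (N h) := continuous_tsum
    (fun n => by simp only [u]; have := hwc (a n); fun_prop) (hgeom ‖h‖) (fun n y => hu h y n)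
  have hNadd (f g y) : N (f + g) y = N f y + N g y := by
    simp only [N]
    rw [← (hsum f y).tsum_add (hsum g y)]
    exact tsum_congr fun n => by simp only [u, ContinuousMap.add_apply]; ring
  have hNsmul (c : ℝ) (f y) : N (c • f) y = c * N f y := by
    simp only [N]
    rw [← tsum_mul_left]
    exact tsum_congr fun n => by simp only [u, ContinuousMap.smul_apply, smul_eq_mul]; ring
  have hNle (h : C(K, ℝ)) (y) (C : ℝ) (hC : ∀ t, 0 < w y t → |h t| ≤ C) :
      |N h y| ≤ C * N 1 y := by
    simp only [N]
    rw [← tsum_mul_left]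
    refine tsum_of_norm_bounded (f := u h y) ((hsum 1 y).mul_left C).hasSum fun n => ?_
    simp only [u, norm_mul, norm_pow, ContinuousMap.one_apply, mul_one, Real.norm_eq_abs,
      abs_of_nonneg (hw0 y (a n))]
    rw [abs_of_nonneg (by norm_num : (0:ℝ) ≤ 1 / 2), mul_left_comm C]
    refine mul_le_mul_of_nonneg_left ?_ (by positivity)
    rcases (hw0 y (a n)).eq_or_lt with h0 | h0
    · simp [← h0]
    · rw [mul_comm C]
      exact mul_le_mul_of_nonneg_left (hC _ h0) h0.le
  have hNpos (y) (hy : y ∉ range e) : 0 < N 1 y := by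
    have hδ : 0 < δ y := (hcl.notMem_iff_infDist_pos hne).1 hy
    obtain ⟨_, ⟨t, rfl⟩, ht⟩ := (Metric.infDist_lt_iff hne).1 (show δ y < 2 * δ y by linarith)
    have hopen : IsOpen {s | dist y (e s) < 2 * δ y} :=
      isOpen_lt (continuous_const.dist he.continuous) continuous_const
    obtain ⟨n, hn⟩ := (TopologicalSpace.denseRange_denseSeq K).exists_mem_open hopen ⟨t, ht⟩
    have hn : dist y (e (a n)) < 2 * δ y := hn
    refine (hsum 1 y).tsum_pos (fun m => ?_) n ?_
    · simpa [u] using hw0 y (a m)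
    · simpa [u, w] using hn
  classical
  -- Off `range e`, the weighted average of `h` over the dense sequence.
  let G (y : Y) : C(K, ℝ) →ₗ[ℝ] ℝ :=
    if hy : y ∈ range e then (ContinuousMap.evalCLM ℝ hy.choose).toLinearMap else
      (N 1 y)⁻¹ • ⟨⟨fun h => N h y, fun f g => hNadd f g y⟩, fun c f => hNsmul c f y⟩
  have hGmem (t : K) (h) : G (e t) h = h t := by
    have hy : e t ∈ range e := mem_range_self t
    simp only [G, dif_pos hy]
    exact congrArg h (he.injective hy.choose_spec)
  have hGnot (y) (hy : y ∉ range e) (h) : G y h = (N 1 y)⁻¹ * N h y := by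
    simp only [G, dif_neg hy]; rfl
  have hGle (y) (hy : y ∉ range e) (h : C(K, ℝ)) (C : ℝ) (hC : ∀ t, 0 < w y t → |h t| ≤ C) :
      |G y h| ≤ C := by
    rw [hGnot y hy, abs_mul, abs_of_pos (inv_pos.2 (hNpos y hy)), inv_mul_le_iff₀ (hNpos y hy),
      mul_comm]
    exact hNle h y C hC
  have hGone (y) : G y 1 = 1 := by
    by_cases hy : y ∈ range e
    · obtain ⟨t, rfl⟩ := hy
      simp [hGmem]
    · rw [hGnot y hy, inv_mul_cancel₀ (hNpos y hy).ne']
  have hGc (h : C(K, ℝ)) : Continuous fun y => G y h := by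
    refine continuous_iff_continuousAt.2 fun y => ?_
    by_cases hy : y ∈ range e
    · obtain ⟨t, rfl⟩ := hy
      rw [Metric.continuousAt_iff]
      intro ε hε
      obtain ⟨η, hη, hηε⟩ := Metric.continuous_iff.1 h.continuous t (ε / 2) (half_pos hε)
      have hηε (s : K) (hs : dist (e s) (e t) < η) : |h s - h t| < ε / 2 := hηε s hs
      -- A point `s` of positive weight satisfies `dist y (e s) < 2 * δ y ≤ 2 * dist y (e t)`, so `e
      -- s` lies within `3 * dist y (e t) < η` of `e t`.
      refine ⟨η / 3, by positivity, fun {y} hyt => ?_⟩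
      rw [hGmem, Real.dist_eq]
      by_cases hy : y ∈ range e
      · obtain ⟨s, rfl⟩ := hy
        rw [hGmem]
        linarith [hηε s (by linarith)]
      · have h1 : G y (h - h t • 1) = G y h - h t := by
          rw [map_sub, map_smul, hGone, smul_eq_mul, mul_one]
        rw [← h1]
        refine (hGle y hy _ (ε / 2) fun s hs => ?_).trans_lt (half_lt_self hε)
        have h2 : dist y (e s) < 2 * δ y := by simpa [w] using hs
        have h3 : δ y ≤ dist y (e t) := Metric.infDist_le_dist_of_mem (mem_range_self t)
        have h4 := dist_triangle_left (e s) (e t) y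
        simpa using (hηε s (by linarith)).le
    · have hev : (fun y => (N 1 y)⁻¹ * N h y) =ᶠ[𝓝 y] fun y => G y h := by
        filter_upwards [hcl.isOpen_compl.mem_nhds hy] with z hz
        exact (hGnot z hz h).symm
      exact (((hNc 1).continuousAt.inv₀ (hNpos y hy).ne').mul (hNc h).continuousAt).congr hev
  obtain ⟨F, hF⟩ := exists_continuousMap_dualBall G (fun y h => by
    by_cases hy : y ∈ range e
    · obtain ⟨t, rfl⟩ := hy
      rw [hGmem]
      exact h.norm_coe_le_norm t
    · exact hGle y hy h _ fun t _ => h.norm_coe_le_norm t) hGc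
  refine ⟨F, fun t => Subtype.ext (DFunLike.ext _ _ fun h => ?_)⟩
  rw [hF, hGmem]
  rfl

/-- If `K` is compact metrizable, the canonical map `K → B_{C(K)*}` extends continuously along
any embedding of `K` into a compact Hausdorff space. -/
theorem exists_extension_evalBall_of_metrizable [TopologicalSpace.MetrizableSpace K]
    {L : Type v} [TopologicalSpace L] [CompactSpace L] [T2Space L] {i : K → L}
    (hi : IsEmbedding i) : ∃ F : C(L, DualBall C(K, ℝ)), ∀ t, F (i t) = evalBall t := by
  let := TopologicalSpace.metrizableSpaceMetric K
  obtain ⟨e, he⟩ := Metric.PiNatEmbed.exists_embedding_to_hilbert_cube (X := K)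
  have hi' : IsClosedEmbedding i := ⟨hi, (isCompact_range hi.continuous).isClosed⟩
  -- `L` need not be metrizable, so the averaging takes place on the Hilbert cube, reached by
  -- Tietze.
  obtain ⟨q, hq⟩ := ContinuousMap.exists_extension hi' ⟨e, he.continuous⟩
  let := TopologicalSpace.metrizableSpaceMetric (ℕ → unitInterval)
  obtain ⟨F, hF⟩ := exists_extension_evalBall he
  refine ⟨F.comp q, fun t => ?_⟩
  have : q (i t) = e t := DFunLike.congr_fun hq t
  simp [this, hF]

end Extension

/-! ### Neighborhood retracts from local left inverses -/

section Retract

/-- A subspace `range i` of `S` is a neighborhood retract as soon as `i` has a continuous left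
inverse on an open set. -/
theorem isNeighborhoodRetract_range {K : Type*} [TopologicalSpace K] {S : Type*}
    [TopologicalSpace S] {i : K → S} (hi : Continuous i) {U : Set S} (hU : IsOpen U)
    (r : C(U, K)) (hr : ∀ t, ∃ ht : i t ∈ U, r ⟨i t, ht⟩ = t) :
    IsNeighborhoodRetract (range i) := by
  refine ⟨U, hU, range_subset_iff.2 fun t => (hr t).1,
    ⟨fun x => ⟨⟨i (r x), (hr (r x)).1⟩, mem_range_self _⟩, by fun_prop⟩, ?_⟩
  rintro ⟨⟨x, hx⟩, t, ht'⟩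
  obtain rfl : i t = x := ht'
  obtain ⟨ht, h⟩ := hr t
  exact Subtype.ext (Subtype.ext (congrArg i h))

end Retract

end LatticeLifting

theorem theorem3p2 (K : Type u) [TopologicalSpace K] [CompactSpace K] [T2Space K]
    (hK : LatticeLifting.HasLatticeLifting C(K, ℝ)) :
    LatticeLifting.IsNeighborhoodRetract
        (Set.range (LatticeLifting.evalBall : K → LatticeLifting.DualBall C(K, ℝ))) ∧
      (TopologicalSpace.MetrizableSpace K → LatticeLifting.IsANR.{u, v} K) := by
  obtain ⟨U, r, hU, hr⟩ := LatticeLifting.exists_local_retraction hK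
  refine ⟨LatticeLifting.isNeighborhoodRetract_range LatticeLifting.continuous_evalBall hU r hr,
    fun _ L _ _ _ i hi => ?_⟩
  obtain ⟨F, hF⟩ := LatticeLifting.exists_extension_evalBall_of_metrizable hi
  refine LatticeLifting.isNeighborhoodRetract_range hi.continuous (hU.preimage F.continuous)
    (r.comp ⟨fun x => ⟨F x, x.2⟩, by fun_prop⟩) fun t => ?_
  obtain ⟨ht, h⟩ := hr t
  refine ⟨by simpa [hF] using ht, ?_⟩
  simp only [ContinuousMap.comp_apply, ContinuousMap.coe_mk, hF, h]
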